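/- Let $N\ge 1$ and let $\mathcal H_1,\dots,\mathcal H_N$ be finite-dimensional complex Hilbert spaces, where each $\mathcal H_k$ has a fixed orthonormal (incoherent) basis $\{|i\rangle\}_{i=1}^{d_k}$. An incoherent operation on $\mathcal H_k$ is given by finitely many Kraus operators of the form $K_r=\sum_i c_r(i)\,|j_r(i)\rangle\langle i|$, with $c_r(i)\in\mathbb C$ and $j_r$ an arbitrary map of $\{1,\dots,d_k\}$ to itself, such that $\sum_r K_r^\dagger K_r=I$. A protocol of local incoherent operations and classical communication (LICC) on $\mathcal H_1\otimes\cdots\otimes\mathcal H_N$ consists of finitely many rounds; in each round one party performs an incoherent operation on its own space and announces the outcome $r$, and the rest of the protocol may depend on the outcomes announced so far. The quantum operation realised by the protocol is the sum over all its branches. An incoherent unitary on $\mathcal H_k$ is an operator $U=\sum_{i} e^{\mathrm i\theta_i}|i\rangle\langle\pi(i)|$ with $\theta_i\in\mathbb R$ and $\pi$ a permutation of $\{1,\dots,d_k\}$. **Theorem.** Let $|\psi\rangle,|\phi\rangle\in\mathcal H_1\otimes\cdots\otimes\mathcal H_N$ be unit vectors. The following are equivalent: 1. there is an LICC protocol that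 transforms $|\psi\rangle\langle\psi|$ into $|\phi\rangle\langle\phi|$ with certainty, and an LICC protocol that transforms $|\phi\rangle\langle\phi|$ into $|\psi\rangle\langle\psi|$ with certainty; 2. there are incoherent unitaries $U_k$ on $\mathcal H_k$, $k=1,\dots,N$, such that $|\phi\rangle=(U_1\otimes\cdots\otimes U_N)|\psi\rangle$. -/

import Mathlib

open scoped Matrix

noncomputable section

namespace Coherence

/-- Index set of the incoherent product basis `|x₁⟩ ⊗ ⋯ ⊗ |x_N⟩` of
`H₁ ⊗ ⋯ ⊗ H_N`, where `dim H_k = d k`. -/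
abbrev Idx {N : ℕ} (d : Fin N → ℕ) : Type := ∀ k : Fin N, Fin (d k)

/-- The Hilbert space `H₁ ⊗ ⋯ ⊗ H_N`, in coordinates with respect to the incoherent product
basis. -/
abbrev Space {N : ℕ} (d : Fin N → ℕ) : Type := EuclideanSpace ℂ (Idx d)

/-- The tensor product operator `A₁ ⊗ ⋯ ⊗ A_N`, as a matrix in the product basis. -/
def tensorOp {N : ℕ} {d : Fin N → ℕ} (A : ∀ k : Fin N, Matrix (Fin (d k)) (Fin (d k)) ℂ) :
    Matrix (Idx d) (Idx d) ℂ :=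
  Matrix.of fun x y => ∏ k, A k (x k) (y k)

/-- The operator `I ⊗ ⋯ ⊗ K ⊗ ⋯ ⊗ I` with `K` acting on party `k`. -/
def localOp {N : ℕ} {d : Fin N → ℕ} (k : Fin N) (K : Matrix (Fin (d k)) (Fin (d k)) ℂ) :
    Matrix (Idx d) (Idx d) ℂ :=
  tensorOp (Function.update (fun l => (1 : Matrix (Fin (d l)) (Fin (d l)) ℂ)) k K)

/-- Incoherent Kraus operators `K = ∑ᵢ c(i) |j(i)⟩⟨i|`, with `j` any map from the index set
of the basis to itself. -/
def IsIncoherentKraus {n : ℕ} (K : Matrix (Fin n) (Fin n) ℂ) : Prop :=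
  ∃ (c : Fin n → ℂ) (j : Fin n → Fin n), K = ∑ i, Matrix.single (j i) i (c i)

/-- The Kraus family of an incoherent operation (IC). -/
def IsICKraus {n m : ℕ} (K : Fin m → Matrix (Fin n) (Fin n) ℂ) : Prop :=
  (∀ r, IsIncoherentKraus (K r)) ∧ ∑ r, (K r)ᴴ * K r = 1

/-- Incoherent unitaries (IU) `U = ∑ᵢ exp(iθᵢ) |i⟩⟨π(i)|` with `π` a permutation. -/
def IsIncoherentUnitary {n : ℕ} (U : Matrix (Fin n) (Fin n) ℂ) : Prop :=
  ∃ (θ : Fin n → ℝ) (π : Equiv.Perm (Fin n)),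
    U = ∑ i, Matrix.single i (π i) (Complex.exp (θ i * Complex.I))

/-- The quantum operations realised by protocols of local incoherent operations and classical
communication (LICC) with finitely many rounds. In a round, one party `k` performs an incoherent
operation with Kraus operators `K r`, and announces the outcome `r`; the parties go on with an LICC
protocol that may depend on `r`. At the end the classical record is discarded, so that the branches
are summed. (A protocol in which less than the full outcome is announced is the special case where
the continuation depends only on the announced part.) -/
inductive IsLICC {N : ℕ} {d : Fin N → ℕ} :
    (Matrix (Idx d) (Idx d) ℂ → Matrix (Idx d) (Idx d) ℂ) → Prop
  | done : IsLICC fun ρ => ρ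
  | round (k : Fin N) (m : ℕ) (K : Fin m → Matrix (Fin (d k)) (Fin (d k)) ℂ)
      (hK : IsICKraus K)
      (Φ : Fin m → Matrix (Idx d) (Idx d) ℂ → Matrix (Idx d) (Idx d) ℂ)
      (hΦ : ∀ r, IsLICC (Φ r)) :
      IsLICC fun ρ => ∑ r, Φ r (localOp k (K r) * ρ * (localOp k (K r))ᴴ)

/-- The projector `|ψ⟩⟨ψ|`. -/
def ketBra {N : ℕ} {d : Fin N → ℕ} (ψ : Space d) : Matrix (Idx d) (Idx d) ℂ :=
  Matrix.of fun x y => ψ x * star (ψ y)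

/-- `|ψ⟩` can be transformed into `|φ⟩` with certainty by an LICC protocol. -/
def LICCConvertible {N : ℕ} {d : Fin N → ℕ} (ψ φ : Space d) : Prop :=
  ∃ Φ : Matrix (Idx d) (Idx d) ℂ → Matrix (Idx d) (Idx d) ℂ,
    IsLICC Φ ∧ Φ (ketBra ψ) = ketBra φ

/-- `|ψ⟩` and `|φ⟩` can be transformed into each other with certainty by LICC protocols. -/
def LICCEquivalent {N : ℕ} {d : Fin N → ℕ} (ψ φ : Space d) : Prop :=
  LICCConvertible ψ φ ∧ LICCConvertible φ ψ

/-- `|φ⟩ = (U₁ ⊗ ⋯ ⊗ U_N) |ψ⟩` for some incoherent unitaries `U_k` on `H_k`. -/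
def LIUEquivalent {N : ℕ} {d : Fin N → ℕ} (ψ φ : Space d) : Prop :=
  ∃ U : ∀ k : Fin N, Matrix (Fin (d k)) (Fin (d k)) ℂ,
    (∀ k, IsIncoherentUnitary (U k)) ∧ Matrix.toEuclideanLin (tensorOp U) ψ = φ

end Coherence

end

namespace Coherence

open Matrix
open scoped ComplexOrder

/-! ### Local operators in coordinates -/

section Vectors

variable {N : ℕ} {d : Fin N → ℕ}

/-! Two quantities cannot increase under LICC on pure states: the squared `ℓ¹` norm of the
unnormalised branch vectors, summed over outcomes (`sum_l1Norm_sq_le`), and the number of basis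
labels of each party that occur (`ncard_localSupport_localOp_le`). Convertibility both ways forces
both to agree for ψ and φ.

Since φ is pure, every branch ends in a multiple of φ. Along a branch of nonzero weight no round can
lose anything: equal label counts make the label map of the Kraus operator injective on the support,
and equality in the `ℓ¹` bound makes its coefficients there equal in modulus. Such an operator acts
on the state as a multiple of an incoherent unitary (`exists_liuEquivalent_of_injOn`). Composing
along the branch (`IsLICC.monotones`) gives ψ ~ a • φ; norms give |a| = 1, and one party absorbs the
phase. -/

theorem toEuclideanLin_coe (M : Matrix (Idx d) (Idx d) ℂ) (ψ : Space d) (x : Idx d) :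
    Matrix.toEuclideanLin M ψ x = ∑ y, M x y * ψ y := rfl

theorem ketBra_toEuclideanLin (M : Matrix (Idx d) (Idx d) ℂ) (ψ : Space d) :
    M * ketBra ψ * Mᴴ = ketBra (Matrix.toEuclideanLin M ψ) := by
  have h : ∀ χ : Space d, ketBra χ = vecMulVec (WithLp.ofLp χ) (star (WithLp.ofLp χ)) :=
    fun _ => rfl
  have h' : WithLp.ofLp (Matrix.toEuclideanLin M ψ) = M *ᵥ (WithLp.ofLp ψ) := rfl
  rw [h, h, h', mul_vecMulVec, vecMulVec_mul, star_mulVec]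

theorem posSemidef_ketBra (ψ : Space d) : (ketBra ψ).PosSemidef :=
  Matrix.posSemidef_vecMulVec_self_star (WithLp.ofLp ψ)

theorem localOp_apply (k : Fin N) (K : Matrix (Fin (d k)) (Fin (d k)) ℂ) (x y : Idx d) :
    localOp k K x y = ∑ i, if y = Function.update x k i then K (x k) i else 0 := by
  have hprod : localOp k K x y =
      K (x k) (y k) * ∏ l ∈ Finset.univ.erase k, if x l = y l then (1 : ℂ) else 0 := by
    simp only [localOp, tensorOp, Matrix.of_apply]
    rw [← Finset.mul_prod_erase _ _ (Finset.mem_univ k)]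
    congr 1
    · simp
    · refine Finset.prod_congr rfl fun l hl => ?_
      rw [Function.update_of_ne (Finset.ne_of_mem_erase hl), Matrix.one_apply]
  have hy : ∀ i, y = Function.update x k i ↔ (i = y k ∧ ∀ l ∈ Finset.univ.erase k, x l = y l) := by
    intro i
    constructor
    · rintro rfl
      refine ⟨by simp, fun l hl => ?_⟩
      rw [Function.update_of_ne (Finset.ne_of_mem_erase hl)]
    · rintro ⟨rfl, h⟩
      rw [eq_comm, Function.update_eq_iff]
      exact ⟨rfl, fun l hl => h l (by simpa using hl)⟩
  rw [hprod, Finset.prod_ite_zero]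
  simp only [hy, ite_and]
  simp

theorem toEuclideanLin_localOp (k : Fin N) (K : Matrix (Fin (d k)) (Fin (d k)) ℂ) (ψ : Space d)
    (x : Idx d) :
    Matrix.toEuclideanLin (localOp k K) ψ x = ∑ i, K (x k) i * ψ (Function.update x k i) := by
  rw [toEuclideanLin_coe]
  simp only [localOp_apply, Finset.sum_mul]
  rw [Finset.sum_comm]
  refine Finset.sum_congr rfl fun i _ => ?_
  simp [ite_mul]

end Vectors

/-! ### Entries of incoherent operators -/

section IncoherentMatrices

variable {n : ℕ}

theorem IsIncoherentUnitary.exists_apply {U : Matrix (Fin n) (Fin n) ℂ}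
    (hU : IsIncoherentUnitary U) : ∃ (u : Fin n → ℂ) (π : Equiv.Perm (Fin n)),
      (∀ i, ‖u i‖ = 1) ∧ ∀ i i', U i i' = if i' = π i then u i else 0 := by
  obtain ⟨θ, π, rfl⟩ := hU
  refine ⟨fun i => Complex.exp (θ i * Complex.I), π,
    fun i => Complex.norm_exp_ofReal_mul_I _, fun i i' => ?_⟩
  simp only [Matrix.sum_apply, Matrix.single_apply, ite_and, eq_comm (a := i')]
  simp

theorem isIncoherentUnitary_of {u : Fin n → ℂ} (π : Equiv.Perm (Fin n)) (hu : ∀ i, ‖u i‖ = 1) :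
    IsIncoherentUnitary (Matrix.of fun i i' => if i' = π i then u i else 0) := by
  refine ⟨fun i => (u i).arg, π, ?_⟩
  ext i i'
  have h : Complex.exp ((u i).arg * Complex.I) = u i := by
    have := Complex.norm_mul_exp_arg_mul_I (u i)
    rwa [hu, Complex.ofReal_one, one_mul] at this
  simp only [Matrix.sum_apply, Matrix.single_apply, ite_and, Matrix.of_apply]
  rw [Finset.sum_ite_eq' Finset.univ i]
  simp [h, eq_comm]

theorem IsIncoherentKraus.exists_apply {K : Matrix (Fin n) (Fin n) ℂ} (hK : IsIncoherentKraus K) :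
    ∃ (c : Fin n → ℂ) (j : Fin n → Fin n), ∀ a i, K a i = if j i = a then c i else 0 := by
  obtain ⟨c, j, rfl⟩ := hK
  refine ⟨c, j, fun a i => ?_⟩
  simp only [Matrix.sum_apply, Matrix.single_apply, and_comm (a := j _ = a), ite_and]
  simp

theorem isIncoherentKraus_of_apply {K : Matrix (Fin n) (Fin n) ℂ} {c : Fin n → ℂ}
    {j : Fin n → Fin n} (h : ∀ a i, K a i = if j i = a then c i else 0) :
    IsIncoherentKraus K := by
  refine ⟨c, j, ?_⟩
  ext a i
  simp only [h, Matrix.sum_apply, Matrix.single_apply, and_comm (a := j _ = a), ite_and]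
  simp

/-- An incoherent unitary on its own is the Kraus family of an incoherent operation. -/
theorem isICKraus_of_unitary {u : Fin n → ℂ} (π : Equiv.Perm (Fin n)) (hu : ∀ i, ‖u i‖ = 1) :
    IsICKraus fun _ : Fin 1 => (Matrix.of fun i i' => if i' = π i then u i else 0 :
      Matrix (Fin n) (Fin n) ℂ) := by
  refine ⟨fun _ => isIncoherentKraus_of_apply (c := fun i => u (π.symm i)) (j := π.symm) ?_, ?_⟩
  · intro a i
    simp only [Matrix.of_apply, Equiv.symm_apply_eq]
    split_ifs with h
    · simp [h]
    · rfl
  · ext i i'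
    simp only [Finset.univ_unique, Finset.sum_const, Finset.card_singleton, one_smul,
      Matrix.mul_apply, Matrix.conjTranspose_apply, Matrix.of_apply, Matrix.one_apply]
    rw [Finset.sum_eq_single (π.symm i)]
    · by_cases h : i = i'
      · subst h
        simp [Complex.conj_mul', hu]
      · simp [h, eq_comm]
    · intro b _ hb
      rw [if_neg fun h => hb (by simp [h])]
      simp
    · simp

theorem sum_norm_sq_of_isICKraus {m : ℕ} {K : Fin m → Matrix (Fin n) (Fin n) ℂ}
    (hK : ∑ r, (K r)ᴴ * K r = 1) {c : Fin m → Fin n → ℂ} {j : Fin m → Fin n → Fin n}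
    (h : ∀ r a i, K r a i = if j r i = a then c r i else 0) (i : Fin n) :
    ∑ r, ‖c r i‖ ^ 2 = 1 := by
  have h1 := congrFun (congrFun hK i) i
  simp only [Matrix.sum_apply, Matrix.mul_apply, Matrix.conjTranspose_apply, h,
    Matrix.one_apply_eq] at h1
  have h2 : ∀ r, ∑ a, star (if j r i = a then c r i else 0) * (if j r i = a then c r i else 0) =
      ((‖c r i‖ ^ 2 : ℝ) : ℂ) := by
    intro r
    rw [Finset.sum_eq_single (j r i)]
    · simp [Complex.conj_mul']
    · intro b _ hb
      simp [hb.symm]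
    · simp
  simp only [h2] at h1
  exact_mod_cast h1

end IncoherentMatrices

/-! ### Local incoherent unitaries as an equivalence relation -/

section LIU

variable {N : ℕ} {d : Fin N → ℕ}

theorem toEuclideanLin_tensorOp {U : ∀ k : Fin N, Matrix (Fin (d k)) (Fin (d k)) ℂ}
    {u : ∀ k, Fin (d k) → ℂ} {π : ∀ k, Equiv.Perm (Fin (d k))}
    (h : ∀ k i i', U k i i' = if i' = π k i then u k i else 0) (ψ : Space d) (x : Idx d) :
    Matrix.toEuclideanLin (tensorOp U) ψ x =
      (∏ k, u k (x k)) * ψ (fun k => π k (x k)) := by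
  rw [toEuclideanLin_coe]
  have h1 : ∀ y : Idx d, tensorOp U x y =
      if y = (fun k => π k (x k)) then ∏ k, u k (x k) else 0 := by
    intro y
    simp only [tensorOp, Matrix.of_apply, h, Finset.prod_ite_zero, funext_iff,
      Finset.mem_univ, true_imp_iff]
  simp [h1, ite_mul]

theorem liuEquivalent_iff {ψ φ : Space d} :
    LIUEquivalent ψ φ ↔ ∃ (u : ∀ k, Fin (d k) → ℂ) (π : ∀ k, Equiv.Perm (Fin (d k))),
      (∀ k i, ‖u k i‖ = 1) ∧ ∀ x, φ x = (∏ k, u k (x k)) * ψ (fun k => π k (x k)) := by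
  constructor
  · rintro ⟨U, hU, rfl⟩
    choose u π hu h using fun k => (hU k).exists_apply
    exact ⟨u, π, hu, toEuclideanLin_tensorOp h ψ⟩
  · rintro ⟨u, π, hu, h⟩
    refine ⟨_, fun k => isIncoherentUnitary_of (π k) (hu k), ?_⟩
    ext x
    exact (toEuclideanLin_tensorOp (fun k i i' => rfl) ψ x).trans (h x).symm

theorem LIUEquivalent.symm {ψ φ : Space d} (h : LIUEquivalent ψ φ) : LIUEquivalent φ ψ := by
  obtain ⟨u, π, hu, h⟩ := liuEquivalent_iff.1 h
  refine liuEquivalent_iff.2 ⟨fun k i => (u k ((π k).symm i))⁻¹, fun k => (π k).symm,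
    fun k i => by simp [hu], fun x => ?_⟩
  have h0 : ∏ k, u k ((π k).symm (x k)) ≠ 0 :=
    Finset.prod_ne_zero_iff.2 fun k _ h0 => by simpa [h0] using hu k ((π k).symm (x k))
  rw [h, Finset.prod_inv_distrib, inv_mul_cancel_left₀ h0]
  simp

theorem LIUEquivalent.trans {ψ ξ φ : Space d} (h₁ : LIUEquivalent ψ ξ) (h₂ : LIUEquivalent ξ φ) :
    LIUEquivalent ψ φ := by
  obtain ⟨u, π, hu, h₁⟩ := liuEquivalent_iff.1 h₁
  obtain ⟨v, τ, hv, h₂⟩ := liuEquivalent_iff.1 h₂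
  refine liuEquivalent_iff.2 ⟨fun k i => v k i * u k (τ k i), fun k => (τ k).trans (π k),
    fun k i => by simp [hu, hv], fun x => ?_⟩
  rw [h₂, h₁, Finset.prod_mul_distrib, mul_assoc]
  rfl

theorem LIUEquivalent.smul {ψ φ : Space d} (h : LIUEquivalent ψ φ) (a : ℂ) :
    LIUEquivalent (a • ψ) (a • φ) := by
  obtain ⟨u, π, hu, h⟩ := liuEquivalent_iff.1 h
  refine liuEquivalent_iff.2 ⟨u, π, hu, fun x => ?_⟩
  simp only [PiLp.smul_apply, smul_eq_mul, h]
  ring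

theorem liuEquivalent_smul_self (hN : 1 ≤ N) (ψ : Space d) {a : ℂ} (ha : ‖a‖ = 1) :
    LIUEquivalent ψ (a • ψ) := by
  -- The first party alone carries the global phase; this needs at least one party.
  refine liuEquivalent_iff.2 ⟨fun k _ => if k = ⟨0, hN⟩ then a else 1, fun _ => 1,
    fun k i => by dsimp only; split_ifs <;> simp [ha], fun x => ?_⟩
  simp

theorem LIUEquivalent.norm_eq {ψ φ : Space d} (h : LIUEquivalent ψ φ) : ‖φ‖ = ‖ψ‖ := by
  obtain ⟨u, π, hu, h⟩ := liuEquivalent_iff.1 h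
  rw [EuclideanSpace.norm_eq, EuclideanSpace.norm_eq]
  congr 1
  rw [← Equiv.sum_comp (Equiv.piCongrRight π) fun x => ‖ψ x‖ ^ 2]
  refine Finset.sum_congr rfl fun x _ => ?_
  rw [h, norm_mul, norm_prod, Finset.prod_congr rfl fun k _ => hu k (x k)]
  simp only [Finset.prod_const_one, one_mul]
  rfl

end LIU

/-! ### Local incoherent unitaries are LICC protocols -/

section LIUtoLICC

variable {N : ℕ} {d : Fin N → ℕ}

theorem LICCConvertible.of_localOp_unitary (k : Fin N) {u : Fin (d k) → ℂ}
    (π : Equiv.Perm (Fin (d k))) (hu : ∀ i, ‖u i‖ = 1) {ψ φ : Space d}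
    (h : LICCConvertible (Matrix.toEuclideanLin
      (localOp k (Matrix.of fun i i' => if i' = π i then u i else 0)) ψ) φ) :
    LICCConvertible ψ φ := by
  obtain ⟨Φ, hΦ, h⟩ := h
  refine ⟨_, IsLICC.round k 1 _ (isICKraus_of_unitary π hu) (fun _ => Φ) fun _ => hΦ, ?_⟩
  simp [ketBra_toEuclideanLin, h]

/-- The parties in `s` apply their unitaries one per round, which allows induction on `s`. -/
theorem liccConvertible_of_partial (u : ∀ k, Fin (d k) → ℂ) (π : ∀ k, Equiv.Perm (Fin (d k)))
    (hu : ∀ k i, ‖u k i‖ = 1) (s : Finset (Fin N)) : ∀ ψ φ : Space d,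
      (∀ x, φ x = (∏ k ∈ s, u k (x k)) * ψ (fun k => if k ∈ s then π k (x k) else x k)) →
      LICCConvertible ψ φ := by
  induction s using Finset.induction_on with
  | empty =>
    intro ψ φ h
    have : φ = ψ := by
      ext x
      simpa using h x
    subst this
    exact ⟨_, IsLICC.done, rfl⟩
  | insert a s ha ih =>
    intro ψ φ h
    refine LICCConvertible.of_localOp_unitary a (π a) (hu a) (ih _ _ fun x => ?_)
    rw [h, toEuclideanLin_localOp, Finset.prod_insert ha, Finset.sum_eq_single (π a (x a))]
    · have hx : (fun k => if k ∈ insert a s then π k (x k) else x k) =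
          Function.update (fun k => if k ∈ s then π k (x k) else x k) a (π a (x a)) := by
        ext1 k
        by_cases hk : k = a
        · subst hk
          simp
        · simp [hk]
      rw [hx]
      simp [ha]
      ring
    · intro b _ hb
      simp [ha, hb]
    · simp

theorem LIUEquivalent.liccConvertible {ψ φ : Space d} (h : LIUEquivalent ψ φ) :
    LICCConvertible ψ φ := by
  obtain ⟨u, π, hu, h⟩ := liuEquivalent_iff.1 h
  exact liccConvertible_of_partial u π hu Finset.univ ψ φ fun x => by simpa using h x

end LIUtoLICC

/-! ### Extremality of pure states -/

section Positivity

variable {N : ℕ} {d : Fin N → ℕ}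

theorem IsLICC.posSemidef {Φ : Matrix (Idx d) (Idx d) ℂ → Matrix (Idx d) (Idx d) ℂ}
    (hΦ : IsLICC Φ) : ∀ {ρ}, ρ.PosSemidef → (Φ ρ).PosSemidef := by
  induction hΦ with
  | done => exact fun h => h
  | round k m K hK Φ hΦ ih =>
    intro ρ hρ
    exact Matrix.posSemidef_sum _ fun r _ => ih r (hρ.mul_mul_conjTranspose_same _)

/-- Positive semidefinite summands of a multiple of a pure state are multiples of it. -/
theorem exists_eq_smul_ketBra_of_sum {m : ℕ} {A : Fin m → Matrix (Idx d) (Idx d) ℂ}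
    (hA : ∀ r, (A r).PosSemidef) {φ : Space d} (hφ : ‖φ‖ = 1) {t : ℝ}
    (h : ∑ r, A r = (t : ℂ) • ketBra φ) :
    ∃ p : Fin m → ℝ, (∀ r, A r = (p r : ℂ) • ketBra φ) ∧ ∑ r, p r = t := by
  set f : Idx d → ℂ := WithLp.ofLp φ with hf
  have hkb : ketBra φ = vecMulVec f (star f) := rfl
  have hff : star f ⬝ᵥ f = 1 := by
    have h1 : inner ℂ φ φ = (1 : ℂ) := by
      rw [inner_self_eq_norm_sq_to_K, hφ]; simp
    rw [EuclideanSpace.inner_eq_star_dotProduct, dotProduct_comm] at h1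
    exact h1
  -- For v orthogonal to φ the nonnegative numbers ⟨v, A r v⟩ sum to zero, so each vanishes and A r
  -- kills v.
  have hker : ∀ v : Idx d → ℂ, star f ⬝ᵥ v = 0 → ∀ r, A r *ᵥ v = 0 := by
    intro v hv
    have h1 : ∑ r, star v ⬝ᵥ (A r *ᵥ v) = 0 := by
      rw [← dotProduct_sum, ← Matrix.sum_mulVec, h, hkb, smul_mulVec, vecMulVec_mulVec, hv]
      simp
    intro r
    rw [Finset.sum_eq_zero_iff_of_nonneg fun r _ => (hA r).dotProduct_mulVec_nonneg v] at h1
    exact ((hA r).dotProduct_mulVec_zero_iff v).1 (h1 r (Finset.mem_univ r))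
  have hAv : ∀ r v, A r *ᵥ v = (star f ⬝ᵥ v) • (A r *ᵥ f) := by
    intro r v
    have := hker (v - (star f ⬝ᵥ v) • f) (by
      rw [dotProduct_sub, dotProduct_smul, hff]; simp) r
    rwa [mulVec_sub, mulVec_smul, sub_eq_zero] at this
  have hA1 : ∀ r, A r = vecMulVec (A r *ᵥ f) (star f) := by
    intro r
    refine Matrix.ext_of_mulVec_single fun i => ?_
    rw [hAv, vecMulVec_mulVec]
    simp
  -- A r factors through ⟨φ|; Hermiticity puts its range in the span of φ as well.
  have hA2 : ∀ r, A r = (star f ⬝ᵥ (A r *ᵥ f)) • ketBra φ := by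
    intro r
    have h2 : A r = vecMulVec f (star (A r *ᵥ f)) := by
      conv_lhs => rw [← (hA r).isHermitian.eq, hA1 r, conjTranspose_vecMulVec, star_star]
    have h3 : A r *ᵥ f = (star (A r *ᵥ f) ⬝ᵥ f) • f := by
      conv_lhs => rw [h2, vecMulVec_mulVec]
      simp
    have h4 : star f ⬝ᵥ (A r *ᵥ f) = star (A r *ᵥ f) ⬝ᵥ f := by
      conv_lhs => rw [h3, dotProduct_smul, hff]
      simp
    rw [h4, hkb, ← smul_vecMulVec, ← h3]
    exact hA1 r
  have hre : ∀ r, (((star f ⬝ᵥ (A r *ᵥ f)).re : ℝ) : ℂ) = star f ⬝ᵥ (A r *ᵥ f) := by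
    intro r
    exact Complex.ext rfl (Complex.nonneg_iff.1 ((hA r).dotProduct_mulVec_nonneg f)).2
  refine ⟨fun r => (star f ⬝ᵥ (A r *ᵥ f)).re, fun r => by rw [hre]; exact hA2 r, ?_⟩
  have h5 : ((∑ r, (star f ⬝ᵥ (A r *ᵥ f)).re : ℝ) : ℂ) = (t : ℂ) := by
    push_cast
    simp only [hre]
    rw [← dotProduct_sum, ← Matrix.sum_mulVec, h, hkb, smul_mulVec, vecMulVec_mulVec, hff]
    simp [hff]
  exact_mod_cast h5

end Positivity

/-! ### The two monotones and their equality cases -/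

section Monotones

variable {N : ℕ} {d : Fin N → ℕ}

/-- The `ℓ¹` norm of a vector in the incoherent product basis. -/
noncomputable def l1Norm (ψ : Space d) : ℝ := ∑ x, ‖ψ x‖

/-- The `ℓ¹` norm of the component `(⟨i| ⊗ I)|ψ⟩`, with `⟨i|` acting on party `k`. -/
noncomputable def l1Slice (k : Fin N) (ψ : Space d) (i : Fin (d k)) : ℝ :=
  ∑ x : Idx d with x k = i, ‖ψ x‖

/-- The basis labels of party `k` that occur in `|ψ⟩`. -/
def localSupport (k : Fin N) (ψ : Space d) : Set (Fin (d k)) :=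
  {i | ∃ x : Idx d, x k = i ∧ ψ x ≠ 0}

theorem l1Slice_nonneg (k : Fin N) (ψ : Space d) (i : Fin (d k)) : 0 ≤ l1Slice k ψ i :=
  Finset.sum_nonneg fun _ _ => norm_nonneg _

theorem sum_l1Slice (k : Fin N) (ψ : Space d) : ∑ i, l1Slice k ψ i = l1Norm ψ :=
  Finset.sum_fiberwise _ _ _

theorem l1Norm_nonneg (ψ : Space d) : 0 ≤ l1Norm ψ :=
  Finset.sum_nonneg fun _ _ => norm_nonneg _

theorem l1Slice_pos {k : Fin N} {ψ : Space d} {i : Fin (d k)} (hi : i ∈ localSupport k ψ) :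
    0 < l1Slice k ψ i := by
  obtain ⟨x, hx, h⟩ := hi
  exact Finset.sum_pos' (fun _ _ => norm_nonneg _) ⟨x, by simp [hx], norm_pos_iff.2 h⟩

theorem sum_update_eq (k : Fin N) (a i : Fin (d k)) (g : Idx d → ℝ) :
    ∑ x : Idx d with x k = a, g (Function.update x k i) = ∑ y : Idx d with y k = i, g y := by
  refine Finset.sum_nbij' (fun x => Function.update x k i) (fun y => Function.update y k a)
    ?_ ?_ ?_ ?_ ?_
  · simp
  · simp
  · intro x hx
    rw [Finset.mem_filter] at hx
    simp [← hx.2]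
  · intro x hx
    rw [Finset.mem_filter] at hx
    simp [← hx.2]
  · simp

/-- Triangle inequality: the slice with label i is moved to label `j i` and scaled by `c i`, and
slices sent to the same label may interfere. -/
theorem l1Norm_localOp_le (k : Fin N) {K : Matrix (Fin (d k)) (Fin (d k)) ℂ}
    {c : Fin (d k) → ℂ} {j : Fin (d k) → Fin (d k)}
    (hK : ∀ a i, K a i = if j i = a then c i else 0) (ψ : Space d) :
    l1Norm (Matrix.toEuclideanLin (localOp k K) ψ) ≤ ∑ i, ‖c i‖ * l1Slice k ψ i := by
  calc l1Norm (Matrix.toEuclideanLin (localOp k K) ψ)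
      ≤ ∑ x : Idx d, ∑ i, if x k = j i then ‖c i‖ * ‖ψ (Function.update x k i)‖ else 0 := by
        refine Finset.sum_le_sum fun x _ => ?_
        rw [toEuclideanLin_localOp]
        refine (norm_sum_le _ _).trans (Finset.sum_le_sum fun i _ => ?_)
        rw [hK, norm_mul]
        split_ifs with h1 h2 h2
        · rfl
        · exact absurd h1.symm h2
        · exact absurd h2.symm h1
        · simp
    _ = ∑ i, ‖c i‖ * l1Slice k ψ i := by
        rw [Finset.sum_comm]
        refine Finset.sum_congr rfl fun i _ => ?_
        rw [← Finset.sum_filter, ← Finset.mul_sum,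
          sum_update_eq k (j i) i (fun y => ‖ψ y‖)]
        rfl

/-- The exact defect yields both the monotonicity of the `ℓ¹` norm and its equality case. -/
theorem sq_sum_sub_sum_sq {m n : ℕ} {γ : Fin m → Fin n → ℝ} (hγ : ∀ i, ∑ r, γ r i ^ 2 = 1)
    (a : Fin n → ℝ) :
    (∑ i, a i) ^ 2 - ∑ r, (∑ i, γ r i * a i) ^ 2 =
      (∑ i, ∑ i', a i * a i' * ∑ r, (γ r i - γ r i') ^ 2) / 2 := by
  have h1 : ∀ i i', ∑ r, (γ r i - γ r i') ^ 2 = 2 - 2 * ∑ r, γ r i * γ r i' := by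
    intro i i'
    simp only [sub_sq, Finset.sum_add_distrib, Finset.sum_sub_distrib, hγ, mul_assoc,
      ← Finset.mul_sum]
    ring
  have h2 : ∑ r, (∑ i, γ r i * a i) ^ 2 = ∑ i, ∑ i', a i * a i' * ∑ r, γ r i * γ r i' := by
    simp only [sq, Finset.mul_sum (ι := Fin m)]
    simp only [Finset.sum_mul_sum]
    rw [Finset.sum_comm]
    refine Finset.sum_congr rfl fun i _ => ?_
    rw [Finset.sum_comm]
    refine Finset.sum_congr rfl fun i' _ => Finset.sum_congr rfl fun r _ => ?_
    ring
  rw [h2, sq, Finset.sum_mul_sum, ← Finset.sum_sub_distrib, Finset.sum_div]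
  refine Finset.sum_congr rfl fun i _ => ?_
  rw [← Finset.sum_sub_distrib, Finset.sum_div]
  refine Finset.sum_congr rfl fun i' _ => ?_
  rw [h1]
  ring

theorem sum_sq_le_sq_sum {m n : ℕ} {γ : Fin m → Fin n → ℝ} (hγ : ∀ i, ∑ r, γ r i ^ 2 = 1)
    {a : Fin n → ℝ} (ha : ∀ i, 0 ≤ a i) :
    ∑ r, (∑ i, γ r i * a i) ^ 2 ≤ (∑ i, a i) ^ 2 := by
  rw [← sub_nonneg, sq_sum_sub_sum_sq hγ]
  exact div_nonneg (Finset.sum_nonneg fun i _ => Finset.sum_nonneg fun i' _ =>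
    mul_nonneg (mul_nonneg (ha i) (ha i')) (Finset.sum_nonneg fun _ _ => sq_nonneg _)) two_pos.le

theorem eq_of_sum_sq_eq_sq_sum {m n : ℕ} {γ : Fin m → Fin n → ℝ} (hγ : ∀ i, ∑ r, γ r i ^ 2 = 1)
    {a : Fin n → ℝ} (ha : ∀ i, 0 ≤ a i) (h : (∑ i, a i) ^ 2 ≤ ∑ r, (∑ i, γ r i * a i) ^ 2)
    {i i' : Fin n} (hi : 0 < a i) (hi' : 0 < a i') (r : Fin m) : γ r i = γ r i' := by
  have hnn : ∀ i i', 0 ≤ a i * a i' * ∑ r, (γ r i - γ r i') ^ 2 := fun i i' =>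
    mul_nonneg (mul_nonneg (ha i) (ha i')) (Finset.sum_nonneg fun _ _ => sq_nonneg _)
  have h0 : ∑ i, ∑ i', a i * a i' * ∑ r, (γ r i - γ r i') ^ 2 = 0 := by
    refine le_antisymm ?_ (Finset.sum_nonneg fun i _ => Finset.sum_nonneg fun i' _ => hnn i i')
    linarith [sq_sum_sub_sum_sq hγ a]
  rw [Finset.sum_eq_zero_iff_of_nonneg fun i _ => Finset.sum_nonneg fun i' _ => hnn i i'] at h0
  have h1 := h0 i (Finset.mem_univ i)
  rw [Finset.sum_eq_zero_iff_of_nonneg fun i' _ => hnn i i'] at h1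
  have h2 := h1 i' (Finset.mem_univ i')
  have h3 := (mul_eq_zero.1 h2).resolve_left (mul_pos hi hi').ne'
  rw [Finset.sum_eq_zero_iff_of_nonneg fun _ _ => sq_nonneg _] at h3
  exact sub_eq_zero.1 (pow_eq_zero_iff two_ne_zero |>.1 (h3 r (Finset.mem_univ r)))

theorem localSupport_localOp_subset_of_ne {k l : Fin N} (hkl : k ≠ l)
    (K : Matrix (Fin (d l)) (Fin (d l)) ℂ) (ψ : Space d) :
    localSupport k (Matrix.toEuclideanLin (localOp l K) ψ) ⊆ localSupport k ψ := by
  rintro _ ⟨x, rfl, hx⟩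
  rw [toEuclideanLin_localOp] at hx
  obtain ⟨i, -, hi⟩ := Finset.exists_ne_zero_of_sum_ne_zero hx
  exact ⟨Function.update x l i, Function.update_of_ne hkl _ _, right_ne_zero_of_mul hi⟩

theorem localSupport_localOp_subset_image {k : Fin N} {K : Matrix (Fin (d k)) (Fin (d k)) ℂ}
    {c : Fin (d k) → ℂ} {j : Fin (d k) → Fin (d k)}
    (hK : ∀ a i, K a i = if j i = a then c i else 0) (ψ : Space d) :
    localSupport k (Matrix.toEuclideanLin (localOp k K) ψ) ⊆ j '' localSupport k ψ := by
  rintro _ ⟨x, rfl, hx⟩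
  rw [toEuclideanLin_localOp] at hx
  obtain ⟨i, -, hi⟩ := Finset.exists_ne_zero_of_sum_ne_zero hx
  refine ⟨i, ⟨Function.update x k i, Function.update_self _ _ _, right_ne_zero_of_mul hi⟩, ?_⟩
  by_contra hne
  simp [hK, hne] at hi

theorem ncard_localSupport_localOp_le (k l : Fin N) {K : Matrix (Fin (d l)) (Fin (d l)) ℂ}
    (hK : IsIncoherentKraus K) (ψ : Space d) :
    (localSupport k (Matrix.toEuclideanLin (localOp l K) ψ)).ncard ≤
      (localSupport k ψ).ncard := by
  by_cases hkl : k = l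
  · subst hkl
    obtain ⟨c, j, h⟩ := hK.exists_apply
    exact (Set.ncard_le_ncard (localSupport_localOp_subset_image h ψ)).trans
      (Set.ncard_image_le (Set.toFinite _))
  · exact Set.ncard_le_ncard (localSupport_localOp_subset_of_ne hkl K ψ)

/-- A Kraus operator that permutes the occurring labels and has coefficients of equal modulus there
acts as a multiple of an incoherent unitary. -/
theorem exists_liuEquivalent_of_injOn {k : Fin N} {K : Matrix (Fin (d k)) (Fin (d k)) ℂ}
    {c : Fin (d k) → ℂ} {j : Fin (d k) → Fin (d k)}
    (hK : ∀ a i, K a i = if j i = a then c i else 0) {ψ : Space d}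
    (hj : Set.InjOn j (localSupport k ψ)) {s : ℝ} (hs : 0 < s)
    (hc : ∀ i ∈ localSupport k ψ, ‖c i‖ = s) :
    ∃ ξ : Space d, LIUEquivalent ψ ξ ∧
      Matrix.toEuclideanLin (localOp k K) ψ = (s : ℂ) • ξ := by
  classical
  have hs0 : (s : ℂ) ≠ 0 := by exact_mod_cast hs.ne'
  -- An injection on a subset of a finite set extends to a permutation.
  obtain ⟨σ, hσ⟩ : ∃ σ : Equiv.Perm (Fin (d k)), ∀ i ∈ localSupport k ψ, σ i = j i := by
    obtain ⟨σ, hσ⟩ := Set.MapsTo.exists_equiv_extend_of_card_eq (t := Finset.univ)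
      (by simp) (s := localSupport k ψ) (f := j) (by simp [Set.MapsTo]) hj
    exact ⟨σ.trans (Equiv.subtypeUnivEquiv Finset.mem_univ), hσ⟩
  -- The value off the support is immaterial, as ψ vanishes there; 1 keeps the modulus right.
  let v : Fin (d k) → ℂ := fun i => if i ∈ localSupport k ψ then c i / s else 1
  have hv : ∀ i, ‖v i‖ = 1 := by
    intro i
    simp only [v]
    split_ifs with hi
    · rw [norm_div, hc i hi, Complex.norm_real, Real.norm_of_nonneg hs.le, div_self hs.ne']
    · exact norm_one
  let u : ∀ l, Fin (d l) → ℂ := Function.update (fun l _ => 1) k fun a => v (σ.symm a)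
  let π : ∀ l, Equiv.Perm (Fin (d l)) := Function.update (fun l => 1) k σ.symm
  let ξ : Space d := WithLp.toLp 2 fun x => (∏ l, u l (x l)) * ψ (fun l => π l (x l))
  refine ⟨ξ, liuEquivalent_iff.2 ⟨u, π, fun l i => ?_, fun x => rfl⟩, ?_⟩
  · by_cases hl : l = k
    · subst hl
      simp [u, hv]
    · simp [u, hl]
  · ext x
    have h1 : ∏ l, u l (x l) = v (σ.symm (x k)) := by
      rw [Finset.prod_eq_single k]
      · simp [u]
      · intro l _ hl
        simp [u, hl]
      · simp
    have h2 : (fun l => π l (x l)) = Function.update x k (σ.symm (x k)) := by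
      ext1 l
      by_cases hl : l = k
      · subst hl
        simp [π]
      · simp [π, hl]
    have hsupp : ∀ i, i ∉ localSupport k ψ → ψ (Function.update x k i) = 0 := by
      intro i hi
      by_contra h
      exact hi ⟨_, Function.update_self _ _ _, h⟩
    have h3 : ((s : ℂ) • ξ) x =
        s * (v (σ.symm (x k)) * ψ (Function.update x k (σ.symm (x k)))) := by
      rw [← h1, ← h2]
      rfl
    rw [h3, toEuclideanLin_localOp, Finset.sum_eq_single (σ.symm (x k))]
    · by_cases hi : σ.symm (x k) ∈ localSupport k ψ
      · have hji : j (σ.symm (x k)) = x k := by rw [← hσ _ hi]; simp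
        rw [hK, if_pos hji]
        simp only [v, if_pos hi]
        field_simp
      · rw [hsupp _ hi]
        simp
    · intro i _ hne
      by_cases hi : i ∈ localSupport k ψ
      · rw [hK, if_neg, zero_mul]
        rw [← hσ i hi]
        exact fun h => hne (by rw [← h]; simp)
      · rw [hsupp _ hi, mul_zero]
    · simp

end Monotones

/-! ### From reversible LICC to incoherent unitaries -/

section LICCtoLIU

variable {N : ℕ} {d : Fin N → ℕ}

theorem sum_l1Norm_sq_le (k : Fin N) {m : ℕ} {K : Fin m → Matrix (Fin (d k)) (Fin (d k)) ℂ}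
    (hK : IsICKraus K) (ψ : Space d) :
    ∑ r, l1Norm (Matrix.toEuclideanLin (localOp k (K r)) ψ) ^ 2 ≤ l1Norm ψ ^ 2 := by
  choose c j h using fun r => (hK.1 r).exists_apply
  rw [← sum_l1Slice k ψ]
  refine le_trans (Finset.sum_le_sum fun r _ => ?_)
    (sum_sq_le_sq_sum (sum_norm_sq_of_isICKraus hK.2 h) (l1Slice_nonneg k ψ))
  exact pow_le_pow_left₀ (l1Norm_nonneg _) (l1Norm_localOp_le k (h r) ψ) 2

/-- A round that preserves the `ℓ¹` norm on average, and the number of labels of the active party in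
a given branch, acts in that branch as a multiple of an incoherent unitary. -/
theorem exists_liuEquivalent_of_round (k : Fin N) {m : ℕ}
    {K : Fin m → Matrix (Fin (d k)) (Fin (d k)) ℂ} (hK : IsICKraus K) {ψ : Space d}
    (h1 : l1Norm ψ ^ 2 ≤ ∑ r, l1Norm (Matrix.toEuclideanLin (localOp k (K r)) ψ) ^ 2)
    {r : Fin m} (h2 : (localSupport k ψ).ncard ≤
      (localSupport k (Matrix.toEuclideanLin (localOp k (K r)) ψ)).ncard)
    (h0 : Matrix.toEuclideanLin (localOp k (K r)) ψ ≠ 0) :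
    ∃ (s : ℝ) (ξ : Space d), 0 < s ∧ LIUEquivalent ψ ξ ∧
      Matrix.toEuclideanLin (localOp k (K r)) ψ = (s : ℂ) • ξ := by
  choose c j h using fun r => (hK.1 r).exists_apply
  have hj : Set.InjOn (j r) (localSupport k ψ) := by
    refine Set.injOn_of_ncard_image_eq (le_antisymm (Set.ncard_image_le (Set.toFinite _)) ?_)
    exact h2.trans (Set.ncard_le_ncard (localSupport_localOp_subset_image (h r) ψ))
  have hc : ∀ i ∈ localSupport k ψ, ∀ i' ∈ localSupport k ψ, ‖c r i‖ = ‖c r i'‖ := by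
    intro i hi i' hi'
    refine eq_of_sum_sq_eq_sq_sum (γ := fun r i => ‖c r i‖) (a := l1Slice k ψ)
      (sum_norm_sq_of_isICKraus hK.2 h)
      (l1Slice_nonneg k ψ) ?_ (l1Slice_pos hi) (l1Slice_pos hi') r
    rw [sum_l1Slice]
    refine h1.trans (Finset.sum_le_sum fun r _ => ?_)
    exact pow_le_pow_left₀ (l1Norm_nonneg _) (l1Norm_localOp_le k (h r) ψ) 2
  obtain ⟨x, hx⟩ : ∃ x, Matrix.toEuclideanLin (localOp k (K r)) ψ x ≠ 0 := by
    by_contra! hx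
    exact h0 (by ext x; exact hx x)
  rw [toEuclideanLin_localOp] at hx
  obtain ⟨i, -, hi⟩ := Finset.exists_ne_zero_of_sum_ne_zero hx
  have hi' : i ∈ localSupport k ψ :=
    ⟨Function.update x k i, Function.update_self _ _ _, right_ne_zero_of_mul hi⟩
  have hci : c r i ≠ 0 := by
    intro h0
    simp [h, h0] at hi
  obtain ⟨ξ, hξ⟩ := exists_liuEquivalent_of_injOn (h r) hj (norm_pos_iff.2 hci)
    fun i' hi'' => hc i' hi'' i hi'
  exact ⟨_, ξ, norm_pos_iff.2 hci, hξ⟩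

theorem eq_smul_of_ketBra_eq {ψ φ : Space d} (hφ : ‖φ‖ = 1) {t : ℝ}
    (h : ketBra ψ = (t : ℂ) • ketBra φ) : ∃ a : ℂ, t = ‖a‖ ^ 2 ∧ ψ = a • φ := by
  obtain ⟨y, hy⟩ : ∃ y, φ y ≠ 0 := by
    by_contra! hx
    have : φ = 0 := by ext x; exact hx x
    simp [this] at hφ
  have h1 : ∀ x y, ψ x * star (ψ y) = t * (φ x * star (φ y)) := fun x y =>
    congrFun (congrFun h x) y
  have hyy : star (φ y) ≠ 0 := star_ne_zero.2 hy
  have hn : ∀ z : ℂ, z * star z = ((‖z‖ ^ 2 : ℝ) : ℂ) := fun z => by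
    push_cast; exact Complex.mul_conj' z
  have ht : t * ‖φ y‖ ^ 2 = ‖ψ y‖ ^ 2 := by
    have := h1 y y
    rw [hn, hn, ← Complex.ofReal_mul] at this
    exact (Complex.ofReal_injective this).symm
  have hpos : 0 < ‖φ y‖ ^ 2 := by positivity
  refine ⟨ψ y / φ y, ?_, ?_⟩
  · rw [norm_div, div_pow, ← ht]
    field_simp
  · ext x
    rw [PiLp.smul_apply, smul_eq_mul]
    by_cases h0 : ψ y = 0
    · have ht0 : t = 0 := by
        rw [h0] at ht
        simpa [hpos.ne', hy] using ht
      have := h1 x x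
      rw [ht0, hn] at this
      simpa [h0] using this
    · have h2 := h1 x y
      have h3 := h1 y y
      have h4 : ψ x * φ y * star (ψ y) = ψ y * φ x * star (ψ y) := by
        linear_combination φ y * h2 - φ x * h3
      have := mul_right_cancel₀ (star_ne_zero.2 h0) h4
      field_simp
      linear_combination this

/-- Branch vectors are left unnormalised, with `t` the weight of the output, so that the induction
applies to each continuation. The third claim relies on the first two for the continuations. -/
theorem IsLICC.monotones {Φ : Matrix (Idx d) (Idx d) ℂ → Matrix (Idx d) (Idx d) ℂ}
    (hΦ : IsLICC Φ) {φ : Space d} (hφ : ‖φ‖ = 1) : ∀ {ψ : Space d} {t : ℝ},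
      Φ (ketBra ψ) = (t : ℂ) • ketBra φ →
      t * l1Norm φ ^ 2 ≤ l1Norm ψ ^ 2 ∧
      (t ≠ 0 → ∀ k, (localSupport k φ).ncard ≤ (localSupport k ψ).ncard) ∧
      (t ≠ 0 → l1Norm ψ ^ 2 ≤ t * l1Norm φ ^ 2 →
        (∀ k, (localSupport k ψ).ncard ≤ (localSupport k φ).ncard) →
        ∃ a : ℂ, LIUEquivalent ψ (a • φ)) := by
  induction hΦ with
  | done =>
    intro ψ t h
    obtain ⟨a, rfl, rfl⟩ := eq_smul_of_ketBra_eq hφ h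
    refine ⟨?_, fun ha k => ?_, fun _ _ _ => ⟨a, liuEquivalent_iff.2
      ⟨fun _ _ => 1, fun _ => 1, by simp, by simp⟩⟩⟩
    · simp [l1Norm, ← Finset.mul_sum, mul_pow]
    · have ha' : a ≠ 0 := by
        rintro rfl
        simp at ha
      simp [localSupport, ha']
  | round k m K hK Φ hΦ ih =>
    intro ψ t h
    simp only [ketBra_toEuclideanLin] at h
    obtain ⟨p, hp, rfl⟩ := exists_eq_smul_ketBra_of_sum
      (fun r => (hΦ r).posSemidef (posSemidef_ketBra
        (Matrix.toEuclideanLin (localOp k (K r)) ψ))) hφ h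
    have hle : ∀ r ∈ Finset.univ, p r * l1Norm φ ^ 2 ≤
        l1Norm (Matrix.toEuclideanLin (localOp k (K r)) ψ) ^ 2 := fun r _ => (ih r (hp r)).1
    have hsum := sum_l1Norm_sq_le k hK ψ
    refine ⟨?_, fun ht l => ?_, fun ht h1 h2 => ?_⟩
    · rw [Finset.sum_mul]
      exact (Finset.sum_le_sum hle).trans hsum
    · obtain ⟨r, -, hr⟩ := Finset.exists_ne_zero_of_sum_ne_zero ht
      exact ((ih r (hp r)).2.1 hr l).trans (ncard_localSupport_localOp_le l k (hK.1 r) ψ)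
    · obtain ⟨r, -, hr⟩ := Finset.exists_ne_zero_of_sum_ne_zero ht
      rw [Finset.sum_mul] at h1
      obtain ⟨-, hr2, hr3⟩ := ih r (hp r)
      -- The bounds close into a cycle, so the termwise inequalities are equalities in every branch.
      have heq : ∀ r ∈ Finset.univ, p r * l1Norm φ ^ 2 =
          l1Norm (Matrix.toEuclideanLin (localOp k (K r)) ψ) ^ 2 :=
        (Finset.sum_eq_sum_iff_of_le hle).1
          (le_antisymm (Finset.sum_le_sum hle) (hsum.trans h1))
      have hl1 : l1Norm φ ≠ 0 := by
        intro h0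
        have : φ = 0 := by
          ext x
          have := (Finset.sum_eq_zero_iff_of_nonneg fun _ _ => norm_nonneg _).1 h0 x
            (Finset.mem_univ x)
          simpa using this
        simp [this] at hφ
      have hne : Matrix.toEuclideanLin (localOp k (K r)) ψ ≠ 0 := by
        intro h0
        have := heq r (Finset.mem_univ r)
        rw [h0] at this
        simp [l1Norm] at this
        exact this.elim hr hl1
      -- The label count is squeezed: that of ψ is at most that of φ, which is at most that of the
      -- branch vector.
      obtain ⟨s, ξ, hs, hξ, hKξ⟩ := exists_liuEquivalent_of_round k hK
        (h1.trans (Finset.sum_le_sum hle)) ((h2 k).trans (hr2 hr k)) hne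
      obtain ⟨a, ha⟩ := hr3 hr (heq r (Finset.mem_univ r)).ge fun l =>
        (ncard_localSupport_localOp_le l k (hK.1 r) ψ).trans (h2 l)
      refine ⟨(s : ℂ)⁻¹ * a, hξ.trans ?_⟩
      have hs0 : (s : ℂ) ≠ 0 := by exact_mod_cast hs.ne'
      have := ha.smul (s : ℂ)⁻¹
      rwa [hKξ, smul_smul, smul_smul, inv_mul_cancel₀ hs0, one_smul] at this

theorem LICCEquivalent.liuEquivalent (hN : 1 ≤ N) {ψ φ : Space d} (hψ : ‖ψ‖ = 1) (hφ : ‖φ‖ = 1)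
    (h : LICCEquivalent ψ φ) : LIUEquivalent ψ φ := by
  obtain ⟨⟨Φ, hΦ, h⟩, Ψ, hΨ, h'⟩ := h
  obtain ⟨-, -, h3⟩ := hΦ.monotones hφ (t := 1) (by simpa using h)
  obtain ⟨h1, h2, -⟩ := hΨ.monotones hψ (t := 1) (by simpa using h')
  obtain ⟨a, ha⟩ := h3 one_ne_zero (by simpa using h1) (h2 one_ne_zero)
  have hn : ‖a‖ = 1 := by
    have := ha.norm_eq
    rwa [norm_smul, hφ, hψ, mul_one] at this
  exact ha.trans (liuEquivalent_smul_self hN φ hn).symm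

end LICCtoLIU

end Coherence

theorem mainTheorem1 {N : ℕ} (hN : 1 ≤ N) (d : Fin N → ℕ)
    (ψ φ : Coherence.Space d) (hψ : ‖ψ‖ = 1) (hφ : ‖φ‖ = 1) :
    Coherence.LICCEquivalent ψ φ ↔ Coherence.LIUEquivalent ψ φ :=
  ⟨fun h => h.liuEquivalent hN hψ hφ, fun h => ⟨h.liccConvertible, h.symm.liccConvertible⟩⟩
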